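/- Let $E$ be a Euclidean vector space of finite dimension $m$ and let $R:\mathbb{R}\to\mathrm{Sym}(E)$ be a smooth one-parameter family of self-adjoint linear maps. Let $\mathrm{Jac}^R$ be the space of all Jacobi fields, i.e. of all solutions $J:\mathbb{R}\to E$ of $J''(t)+R(t)J(t)=0$, with the symplectic form $\omega(X,Y)=\langle X,Y'\rangle-\langle X',Y\rangle$ (whose value does not depend on $t$). A Lagrangian is a maximal subspace $L\subset\mathrm{Jac}^R$ on which $\omega$ vanishes. For $t\in\mathbb{R}$ let $\operatorname{ind}_L(t)=\dim\{J\in L: J(t)=0\}$, and for an interval $I\subset\mathbb{R}$ let $\operatorname{ind}_L I=\sum_{t\in I}\operatorname{ind}_L(t)\in\{0,1,2,\dots,\infty\}$. Suppose that for some $\delta>0$ we have $R\ge\delta$, i.e. $\langle R(t)v,v\rangle\ge\delta\|v\|^2$ for all $t\in\mathbb{R}$ and $v\in E$. Then for every $a\in\mathbb{R}$, every Lagrangian $L\subset\mathrm{Jac}^R$ and every positive integer $r$, the index $\operatorname{ind}_L[a,a+r\pi/\sqrt{\delta}]$ is finite and $$\operatorname{ind}_L\left[a,a+\frac{r\pi}{\sqrt{\delta}}\right]\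 \ge\ rm+\operatorname{ind}_L(a).$$ -/

import Mathlib

open scoped ContDiff

noncomputable section

namespace AbstractJacobi

variable {E : Type*} [NormedAddCommGroup E] [InnerProductSpace ℝ E]

/-- The space of `R`-Jacobi fields: all twice differentiable `J : ℝ → E` with
`J'' (t) + R(t) J(t) = 0` for every real `t`. -/
def jacobiFields (R : ℝ → E →L[ℝ] E) : Submodule ℝ (ℝ → E) where
  carrier := {J | Differentiable ℝ J ∧ Differentiable ℝ (deriv J) ∧
    ∀ t, deriv (deriv J) t + R t (J t) = 0}
  zero_mem' := by
    have h : deriv (0 : ℝ → E) = 0 := by ext t; simp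
    refine ⟨differentiable_const 0, ?_, fun t => ?_⟩
    · rw [h]; exact differentiable_const 0
    · rw [h, h]; simp
  add_mem' := by
    rintro X Y ⟨hX, hX', hXe⟩ ⟨hY, hY', hYe⟩
    have h : deriv (X + Y) = deriv X + deriv Y := by
      ext t; exact deriv_add (hX t) (hY t)
    refine ⟨hX.add hY, ?_, fun t => ?_⟩
    · rw [h]; exact hX'.add hY'
    · rw [h, deriv_add (hX' t) (hY' t), Pi.add_apply, map_add, add_add_add_comm, hXe, hYe,
        add_zero]
  smul_mem' := by
    rintro c X ⟨hX, hX', hXe⟩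
    have h : deriv (c • X) = c • deriv X := by
      ext t; exact deriv_const_smul c (hX t)
    refine ⟨hX.const_smul c, ?_, fun t => ?_⟩
    · rw [h]; exact hX'.const_smul c
    · rw [h, deriv_const_smul c (hX' t), Pi.smul_apply, map_smul, ← smul_add, hXe, smul_zero]

/-- The symplectic form `ω(X, Y) = ⟨X, Y'⟩ - ⟨X', Y⟩`, evaluated at time `0`; by
`symplecticForm_eq` any other time gives the same value when `R` is self-adjoint. -/
def symplecticForm {R : ℝ → E →L[ℝ] E} (X Y : jacobiFields R) : ℝ :=
  inner ℝ ((X : ℝ → E) 0) (deriv (Y : ℝ → E) 0) - inner ℝ (deriv (X : ℝ → E) 0) ((Y : ℝ → E) 0)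

theorem symplecticForm_eq {R : ℝ → E →L[ℝ] E}
    (hR : ∀ t, (R t : E →ₗ[ℝ] E).IsSymmetric) (X Y : jacobiFields R) (t : ℝ) :
    symplecticForm X Y = inner ℝ ((X : ℝ → E) t) (deriv (Y : ℝ → E) t) -
      inner ℝ (deriv (X : ℝ → E) t) ((Y : ℝ → E) t) := by
  obtain ⟨X, hX, hX', hXe⟩ := X
  obtain ⟨Y, hY, hY', hYe⟩ := Y
  have hd : ∀ s, HasDerivAt
      (fun s => inner ℝ (X s) (deriv Y s) - inner ℝ (deriv X s) (Y s) : ℝ → ℝ) 0 s := by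
    intro s
    have h := ((hX s).hasDerivAt.inner ℝ (hY' s).hasDerivAt).sub
      ((hX' s).hasDerivAt.inner ℝ (hY s).hasDerivAt)
    refine h.congr_deriv ?_
    have hs : inner ℝ (R s (X s)) (Y s) = inner ℝ (X s) (R s (Y s)) := hR s (X s) (Y s)
    rw [eq_neg_of_add_eq_zero_left (hXe s), eq_neg_of_add_eq_zero_left (hYe s),
      inner_neg_left, inner_neg_right, hs]
    ring
  exact is_const_of_deriv_eq_zero (fun s => (hd s).differentiableAt) (fun s => (hd s).deriv) 0 t

/-- A space of Jacobi fields is isotropic when the symplectic form vanishes on it. -/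
def IsIsotropic {R : ℝ → E →L[ℝ] E} (W : Submodule ℝ (jacobiFields R)) : Prop :=
  ∀ X ∈ W, ∀ Y ∈ W, symplecticForm X Y = 0

/-- A Lagrangian is a maximal isotropic subspace of the space of Jacobi fields. -/
def IsLagrangian {R : ℝ → E →L[ℝ] E} (L : Submodule ℝ (jacobiFields R)) : Prop :=
  Maximal IsIsotropic L

/-- The fields in `W` that vanish at time `t`. -/
def vanishingAt {R : ℝ → E →L[ℝ] E} (W : Submodule ℝ (jacobiFields R)) (t : ℝ) :
    Submodule ℝ (jacobiFields R) where
  carrier := {J | J ∈ W ∧ (J : ℝ → E) t = 0}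
  zero_mem' := ⟨W.zero_mem, rfl⟩
  add_mem' := by
    rintro X Y ⟨hX, hX0⟩ ⟨hY, hY0⟩
    exact ⟨W.add_mem hX hY, by simp [hX0, hY0]⟩
  smul_mem' := by
    rintro c X ⟨hX, hX0⟩
    exact ⟨W.smul_mem c hX, by simp [hX0]⟩

/-- The index of `W` at the time `t`: the dimension of the space of fields in `W` vanishing
at `t`. -/
def indexAt {R : ℝ → E →L[ℝ] E} (W : Submodule ℝ (jacobiFields R)) (t : ℝ) : ℕ :=
  Module.finrank ℝ (vanishingAt W t)

/-- The index of `W` in `I`: the number of zeros in `I` of fields in `W`, each time `t ∈ I`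
counted with the multiplicity `indexAt W t`. It is the supremum of the sums over finite sets
of times in `I`, so it is `⊤` exactly when there are infinitely many such zeros. -/
def index {R : ℝ → E →L[ℝ] E} (W : Submodule ℝ (jacobiFields R)) (I : Set ℝ) : ℕ∞ :=
  ⨆ (s : Finset ℝ) (_ : (s : Set ℝ) ⊆ I), ((∑ t ∈ s, indexAt W t : ℕ) : ℕ∞)

end AbstractJacobi

end

/-! Identify the Lagrangian with `E`: its fields become the columns of an operator solution `A'' + R
A = 0` with `⟨A' x, A y⟩` symmetric, and the index at `t` is `dim ker A t`. By this symmetry `A' t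
(ker A t)` is the orthogonal complement of `range (A t)`.

Suppose the singular times in `(c, c + π/√δ]` had total multiplicity below `m`. Then the spaces `A'
t (ker A t)` would not span `E`, and some unit vector `v` orthogonal to all of them would lie in
`range (A t)` throughout the interval. With `A y = v`, the function `q = ⟨A' y, v⟩` satisfies `q' =
-‖A' y‖² - ⟨R v, v⟩ ≤ -q² - δ` at regular times and extends continuously over the singular ones
(`continuousWithinAt_riccatiForm`). Such a `q` cannot exist on a half-open interval of length `π/√δ`
(`riccati_length_lt`), a contradiction.

Consecutive half-open intervals are disjoint, so `r` of them contribute `r m`, and the excluded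
endpoint `a` adds its own index. Finiteness holds because singular times are isolated: `A`
degenerates only to first order. -/

noncomputable section

namespace AbstractJacobi

open Set Filter Topology

/-! ### Existence and uniqueness for linear differential equations -/

section LinearODE

variable {F : Type*} [NormedAddCommGroup F] [NormedSpace ℝ F]

/-- The terms of the Picard series of the linear equation `u' = M u` with `u 0 = x`. -/
def picardTerm (M : ℝ → F →L[ℝ] F) (x : F) : ℕ → ℝ → F
  | 0 => fun _ => x
  | n + 1 => fun t => ∫ s in (0 : ℝ)..t, M s (picardTerm M x n s)

theorem continuous_picardTerm [CompleteSpace F] {M : ℝ → F →L[ℝ] F} (hM : Continuous M) (x : F)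
    (n : ℕ) : Continuous (picardTerm M x n) := by
  induction n with
  | zero => exact continuous_const
  | succ n ih =>
    exact intervalIntegral.continuous_primitive
      (fun a b => (hM.clm_apply ih).intervalIntegrable a b) 0

theorem hasDerivAt_picardTerm_succ [CompleteSpace F] {M : ℝ → F →L[ℝ] F} (hM : Continuous M)
    (x : F) (n : ℕ) (t : ℝ) :
    HasDerivAt (picardTerm M x (n + 1)) (M t (picardTerm M x n t)) t :=
  (hM.clm_apply (continuous_picardTerm hM x n)).integral_hasStrictDerivAt 0 t |>.hasDerivAt

/-- Each iteration integrates `|s| ^ n`; the resulting factorial makes the Picard series converge on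
every bounded interval, however long. -/
theorem norm_picardTerm_le [CompleteSpace F] {M : ℝ → F →L[ℝ] F} (x : F)
    {T K : ℝ} (hK : ∀ t, |t| ≤ T → ‖M t‖ ≤ K) (n : ℕ) (t : ℝ) (ht : |t| ≤ T) :
    ‖picardTerm M x n t‖ ≤ (K * |t|) ^ n / n.factorial * ‖x‖ := by
  induction n generalizing t with
  | zero => simp [picardTerm]
  | succ n ih =>
    have hK0 : 0 ≤ K := (norm_nonneg _).trans (hK t ht)
    have hbound : ∀ s ∈ uIoc 0 t, ‖M s (picardTerm M x n s)‖ ≤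
        K ^ (n + 1) / n.factorial * ‖x‖ * |s - 0| ^ n := by
      intro s hs
      have hs' : |s| ≤ T := by
        refine le_trans ?_ ht
        rcases le_total 0 t with h | h
        · rw [uIoc_of_le h] at hs
          rw [abs_of_pos hs.1, abs_of_nonneg h]; exact hs.2
        · rw [uIoc_of_ge h] at hs
          rw [abs_of_nonpos hs.2, abs_of_nonpos h]; linarith [hs.1]
      calc ‖M s (picardTerm M x n s)‖ ≤ ‖M s‖ * ‖picardTerm M x n s‖ := (M s).le_opNorm _
        _ ≤ K * ((K * |s|) ^ n / n.factorial * ‖x‖) := by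
          gcongr
          · exact hK s hs'
          · exact ih s hs'
        _ = _ := by rw [sub_zero, mul_pow]; ring
    calc ‖picardTerm M x (n + 1) t‖
        = ‖∫ s in uIoc 0 t, M s (picardTerm M x n s)‖ :=
          intervalIntegral.norm_intervalIntegral_eq _ _ _ _
      _ ≤ ∫ s in uIoc 0 t, K ^ (n + 1) / n.factorial * ‖x‖ * |s - 0| ^ n := by
        refine MeasureTheory.norm_integral_le_of_norm_le
          (Continuous.integrableOn_uIoc (by fun_prop)) ?_
        exact (MeasureTheory.ae_restrict_mem measurableSet_uIoc).mono hbound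
      _ = (K * |t|) ^ (n + 1) / (n + 1).factorial * ‖x‖ := by
        rw [MeasureTheory.integral_const_mul, integral_pow_abs_sub_uIoc, sub_zero,
          Nat.factorial_succ, mul_pow]
        push_cast
        have : (n.factorial : ℝ) ≠ 0 := by positivity
        field_simp

/-- Linear differential equations with continuous coefficients have global solutions. -/
theorem exists_hasDerivAt_linear [CompleteSpace F] {M : ℝ → F →L[ℝ] F} (hM : Continuous M)
    (x : F) : ∃ u : ℝ → F, u 0 = x ∧ ∀ t, HasDerivAt u (M t (u t)) t := by
  have hterm0 : ∀ n, n ≠ 0 → picardTerm M x n 0 = 0 := by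
    intro n hn
    obtain ⟨k, rfl⟩ := Nat.exists_eq_succ_of_ne_zero hn
    simp [picardTerm]
  refine ⟨fun t => ∑' n, picardTerm M x n t, ?_, fun t => ?_⟩
  · beta_reduce
    rw [tsum_eq_single 0 hterm0]; rfl
  · obtain ⟨T, hT⟩ : ∃ T, T = |t| + 1 := ⟨_, rfl⟩
    have hT0 : 0 < T := by rw [hT]; positivity
    obtain ⟨K, hK⟩ : ∃ K, ∀ s, |s| ≤ T → ‖M s‖ ≤ K := by
      obtain ⟨K, hK⟩ := (isCompact_Icc (a := -T) (b := T)).exists_bound_of_continuousOn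
        hM.continuousOn
      exact ⟨K, fun s hs => hK s (abs_le.mp hs)⟩
    have hK0 : 0 ≤ K := (norm_nonneg _).trans (hK 0 (by simpa using hT0.le))
    have hb : ∀ n s, |s| ≤ T → ‖picardTerm M x n s‖ ≤ (K * T) ^ n / n.factorial * ‖x‖ := by
      intro n s hs
      refine (norm_picardTerm_le x hK n s hs).trans ?_
      gcongr
    have hs0 : Summable fun n : ℕ => (K * T) ^ n / n.factorial * ‖x‖ :=
      (Real.summable_pow_div_factorial _).mul_right _
    have hsum : ∀ s, |s| ≤ T → Summable fun n => picardTerm M x n s := fun s hs =>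
      Summable.of_norm_bounded hs0 fun n => hb n s hs
    have hmem : ∀ s ∈ Ioo (-T) T, |s| ≤ T := fun s hs => (abs_lt.mpr hs).le
    have htT : t ∈ Ioo (-T) T := abs_lt.mp (by rw [hT]; linarith)
    -- The constant zeroth term is split off: the derivative of term `n + 1` is `M` applied to term
    -- `n`, so the shifted series differentiates to `M` applied to the full one.
    have hd : HasDerivAt (fun s => ∑' n, picardTerm M x (n + 1) s)
        (∑' n, M t (picardTerm M x n t)) t := by
      refine hasDerivAt_tsum_of_isPreconnected (t := Ioo (-T) T) (y₀ := 0) (hs0.mul_left K)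
        isOpen_Ioo isPreconnected_Ioo (fun n s _ => hasDerivAt_picardTerm_succ hM x n s) ?_
        (by constructor <;> linarith) ?_ htT
      · intro n s hs
        refine ((M s).le_opNorm _).trans ?_
        gcongr
        · exact hK s (hmem s hs)
        · exact hb n s (hmem s hs)
      · exact (summable_nat_add_iff 1).mpr (hsum 0 (by simpa using hT0.le))
    rw [← (M t).map_tsum (hsum t (hmem t htT))] at hd
    refine (hd.const_add x).congr_of_eventuallyEq ?_
    filter_upwards [isOpen_Ioo.mem_nhds htT] with s hs
    rw [(hsum s (hmem s hs)).tsum_eq_zero_add]; rfl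

theorem eq_zero_of_hasDerivAt_linear {M : ℝ → F →L[ℝ] F} (hM : Continuous M) {u : ℝ → F}
    (hu : ∀ t, HasDerivAt u (M t (u t)) t) {t₀ : ℝ} (h0 : u t₀ = 0) :
    u = 0 := by
  funext t
  obtain ⟨K, hK⟩ := (isCompact_Icc (a := -(|t| + |t₀| + 1)) (b := |t| + |t₀| + 1)).exists_bound_of_continuousOn
    hM.continuousOn
  have hab := abs_nonneg t
  have hab₀ := abs_nonneg t₀
  refine ODE_solution_unique_of_mem_Ioo (v := fun s => M s) (s := fun _ => univ)
    (K := K.toNNReal) (a := -(|t| + |t₀| + 1)) (b := |t| + |t₀| + 1) (t₀ := t₀) (g := 0) ?_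
    ⟨by linarith [neg_abs_le t₀], by linarith [le_abs_self t₀]⟩ (fun s _ => ⟨hu s, trivial⟩) ?_ h0 ?_
  · intro s hs
    refine ((M s).lipschitz.weaken ?_).lipschitzOnWith
    exact NNReal.le_toNNReal_of_coe_le (hK s ⟨hs.1.le, hs.2.le⟩)
  · intro s _
    refine ⟨?_, trivial⟩
    simp only [Pi.zero_apply, map_zero]
    exact hasDerivAt_const s (0 : F)
  · constructor <;> linarith [neg_abs_le t, le_abs_self t]

end LinearODE

/-! ### Jacobi fields as a symplectic space; dimension of Lagrangians -/

section Lagrangian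

variable {E : Type*} [NormedAddCommGroup E] [InnerProductSpace ℝ E] {R : ℝ → E →L[ℝ] E}

/-- The coefficients of the first order system equivalent to the Jacobi equation. -/
def phaseField (R : ℝ → E →L[ℝ] E) (t : ℝ) : E × E →L[ℝ] E × E :=
  (ContinuousLinearMap.snd ℝ E E).prod (-(R t ∘L ContinuousLinearMap.fst ℝ E E))

theorem continuous_phaseField (hR : Continuous R) : Continuous (phaseField R) := by
  have h : Continuous fun t => R t ∘L ContinuousLinearMap.fst ℝ E E := hR.clm_comp_const _
  exact (ContinuousLinearMap.prodₗᵢ (𝕜 := ℝ) (E := E × E) (F := E) (G := E) ℝ).continuous.comp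
    (continuous_const.prodMk h.neg)

theorem hasDerivAt_jacobiField (J : jacobiFields R) (t : ℝ) :
    HasDerivAt (J : ℝ → E) (deriv (J : ℝ → E) t) t :=
  (J.2.1 t).hasDerivAt

theorem hasDerivAt_deriv_jacobiField (J : jacobiFields R) (t : ℝ) :
    HasDerivAt (deriv (J : ℝ → E)) (-(R t ((J : ℝ → E) t))) t :=
  (J.2.2.1 t).hasDerivAt.congr_deriv (eq_neg_of_add_eq_zero_left (J.2.2.2 t))

theorem deriv_add_jacobiField (X Y : jacobiFields R) (t : ℝ) :
    deriv ((X + Y : jacobiFields R) : ℝ → E) t = deriv (X : ℝ → E) t + deriv (Y : ℝ → E) t :=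
  ((hasDerivAt_jacobiField X t).add (hasDerivAt_jacobiField Y t)).deriv

theorem deriv_smul_jacobiField (c : ℝ) (X : jacobiFields R) (t : ℝ) :
    deriv ((c • X : jacobiFields R) : ℝ → E) t = c • deriv (X : ℝ → E) t :=
  ((hasDerivAt_jacobiField X t).const_smul c).deriv

/-- A Jacobi field together with its derivative at a given time. -/
def phaseAt (R : ℝ → E →L[ℝ] E) (t : ℝ) : jacobiFields R →ₗ[ℝ] E × E where
  toFun J := ((J : ℝ → E) t, deriv (J : ℝ → E) t)
  map_add' X Y := by rw [deriv_add_jacobiField]; rfl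
  map_smul' c X := by rw [deriv_smul_jacobiField]; rfl

theorem phaseAt_injective (hR : Continuous R) (t₀ : ℝ) :
    Function.Injective (phaseAt R t₀) := by
  rw [← LinearMap.ker_eq_bot, LinearMap.ker_eq_bot']
  intro J hJ
  have h := eq_zero_of_hasDerivAt_linear (continuous_phaseField hR)
    (u := fun t => phaseAt R t J)
    (fun t => (hasDerivAt_jacobiField J t).prodMk (hasDerivAt_deriv_jacobiField J t)) hJ
  ext t
  exact congrArg Prod.fst (congrFun h t)

theorem phaseAt_zero_surjective [CompleteSpace E] (hR : Continuous R) :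
    Function.Surjective (phaseAt R 0) := by
  intro p
  obtain ⟨u, hu0, hu⟩ := exists_hasDerivAt_linear (continuous_phaseField hR) p
  have h1 : ∀ t, HasDerivAt (fun t => (u t).1) (u t).2 t := fun t =>
    (hasFDerivAt_fst (𝕜 := ℝ) (p := u t)).comp_hasDerivAt t (hu t)
  have h2 : ∀ t, HasDerivAt (fun t => (u t).2) (-(R t (u t).1)) t := fun t =>
    (hasFDerivAt_snd (𝕜 := ℝ) (p := u t)).comp_hasDerivAt t (hu t)
  have hd : deriv (fun t => (u t).1) = fun t => (u t).2 := funext fun t => (h1 t).deriv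
  have hJ : (fun t => (u t).1) ∈ jacobiFields R := by
    refine ⟨fun t => (h1 t).differentiableAt, ?_, fun t => ?_⟩
    · rw [hd]; exact fun t => (h2 t).differentiableAt
    · rw [hd, (h2 t).deriv]; exact neg_add_cancel _
  exact ⟨⟨_, hJ⟩, Prod.ext (congrArg Prod.fst hu0 :)
    ((congrFun hd 0).trans (congrArg Prod.snd hu0))⟩

/-- Jacobi fields are determined by their initial values, which are arbitrary. -/
def phaseEquiv [CompleteSpace E] (hR : Continuous R) : jacobiFields R ≃ₗ[ℝ] E × E :=
  LinearEquiv.ofBijective (phaseAt R 0) ⟨phaseAt_injective hR 0, phaseAt_zero_surjective hR⟩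

/-- The symplectic form as a bilinear form. -/
def symplecticBilin (R : ℝ → E →L[ℝ] E) : LinearMap.BilinForm ℝ (jacobiFields R) :=
  LinearMap.mk₂ ℝ symplecticForm
    (fun X Y Z => by
      simp only [symplecticForm, deriv_add_jacobiField]
      simp only [Submodule.coe_add, Pi.add_apply,
        inner_add_left]
      ring)
    (fun c X Z => by
      simp only [symplecticForm, deriv_smul_jacobiField]
      simp only [Submodule.coe_smul, Pi.smul_apply,
        real_inner_smul_left, smul_eq_mul]
      ring)
    (fun X Y Z => by
      simp only [symplecticForm, deriv_add_jacobiField]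
      simp only [Submodule.coe_add, Pi.add_apply,
        inner_add_right]
      ring)
    (fun c X Z => by
      simp only [symplecticForm, deriv_smul_jacobiField]
      simp only [Submodule.coe_smul, Pi.smul_apply,
        real_inner_smul_right, smul_eq_mul]
      ring)

theorem symplecticForm_swap (X Y : jacobiFields R) : symplecticForm X Y = -symplecticForm Y X := by
  simp only [symplecticForm]
  rw [real_inner_comm (deriv (Y : ℝ → E) 0), real_inner_comm ((Y : ℝ → E) 0)]
  ring

theorem isRefl_symplecticBilin : LinearMap.IsRefl (symplecticBilin R) := fun X Y h => by
  have h' : symplecticForm X Y = 0 := h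
  exact (symplecticForm_swap Y X).trans (by rw [h', neg_zero])

/-- Pairing `X` with the field whose initial data are `(-X' 0, X 0)` gives `‖X 0‖² + ‖X' 0‖²`. -/
theorem nondegenerate_symplecticBilin [CompleteSpace E] (hR : Continuous R) :
    (symplecticBilin R).Nondegenerate := by
  refine (LinearMap.IsRefl.nondegenerate_iff_separatingLeft isRefl_symplecticBilin).mpr ?_
  intro X hX
  obtain ⟨Y, hY⟩ := phaseAt_zero_surjective hR (-deriv (X : ℝ → E) 0, (X : ℝ → E) 0)
  have hY1 : (Y : ℝ → E) 0 = -deriv (X : ℝ → E) 0 := congrArg Prod.fst hY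
  have hY2 : deriv (Y : ℝ → E) 0 = (X : ℝ → E) 0 := congrArg Prod.snd hY
  have h : symplecticForm X Y = 0 := hX Y
  rw [symplecticForm, hY1, hY2, inner_neg_right, real_inner_self_eq_norm_sq,
    real_inner_self_eq_norm_sq] at h
  have h1 : ‖(X : ℝ → E) 0‖ = 0 := by
    nlinarith [sq_nonneg ‖(X : ℝ → E) 0‖, sq_nonneg ‖deriv (X : ℝ → E) 0‖]
  have h2 : ‖deriv (X : ℝ → E) 0‖ = 0 := by
    nlinarith [sq_nonneg ‖(X : ℝ → E) 0‖, sq_nonneg ‖deriv (X : ℝ → E) 0‖]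
  refine phaseAt_injective hR 0 ?_
  rw [map_zero]
  exact Prod.ext (norm_eq_zero.mp h1) (norm_eq_zero.mp h2)

/-- Since `ω(X, X) = 0`, any `X` that is `ω`-orthogonal to `L` can be adjoined to `L` without losing
isotropy, so maximality puts it in `L`. -/
theorem IsLagrangian.orthogonal_eq {L : Submodule ℝ (jacobiFields R)} (hL : IsLagrangian L) :
    (symplecticBilin R).orthogonal L = L := by
  refine le_antisymm (fun X hX => ?_) (fun X hX Y hY => hL.prop Y hY X hX)
  have hself : symplecticForm X X = 0 := by linarith [symplecticForm_swap X X]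
  have hiso : IsIsotropic (L ⊔ Submodule.span ℝ {X}) := by
    intro Y hY Z hZ
    obtain ⟨Y₁, hY₁, _, hc, rfl⟩ := Submodule.mem_sup.mp hY
    obtain ⟨Z₁, hZ₁, _, hd, rfl⟩ := Submodule.mem_sup.mp hZ
    obtain ⟨c, rfl⟩ := Submodule.mem_span_singleton.mp hc
    obtain ⟨d, rfl⟩ := Submodule.mem_span_singleton.mp hd
    have hYX : symplecticForm Y₁ X = 0 := hX Y₁ hY₁
    have hXZ : symplecticForm X Z₁ = 0 := isRefl_symplecticBilin Z₁ X (hX Z₁ hZ₁)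
    have hYZ := hL.prop Y₁ hY₁ Z₁ hZ₁
    change symplecticBilin R _ _ = 0
    change symplecticBilin R _ _ = 0 at hself hYX hXZ hYZ
    simp [hself, hYX, hXZ, hYZ]
  exact hL.le_of_ge hiso le_sup_left (Submodule.mem_sup_right (Submodule.mem_span_singleton_self X))

theorem IsLagrangian.finrank_eq [FiniteDimensional ℝ E] (hR : Continuous R)
    {L : Submodule ℝ (jacobiFields R)} (hL : IsLagrangian L) :
    Module.finrank ℝ L = Module.finrank ℝ E := by
  have := (phaseEquiv hR).symm.finiteDimensional
  have h := LinearMap.BilinForm.finrank_orthogonal (nondegenerate_symplecticBilin hR) L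
  rw [hL.orthogonal_eq, (phaseEquiv hR).finrank_eq, Module.finrank_prod] at h
  have hle := Submodule.finrank_le L
  rw [(phaseEquiv hR).finrank_eq, Module.finrank_prod] at hle
  omega

end Lagrangian

/-! ### Singularities of Lagrange tensors -/

section LagrangeTensor

variable {E : Type*} [NormedAddCommGroup E] [InnerProductSpace ℝ E]

/-- `A` is a Lagrange tensor with derivative `A'`: a solution of `A'' + R A = 0` in the
endomorphisms of `E` whose columns `A · x` span a Lagrangian. -/
structure IsLagrangeTensor (R A A' : ℝ → E →L[ℝ] E) : Prop where
  hasDerivAt : ∀ t, HasDerivAt A (A' t) t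
  hasDerivAt' : ∀ t, HasDerivAt A' (-(R t ∘L A t)) t
  inner_comm : ∀ t x y, inner ℝ (A' t x) (A t y) = inner ℝ (A t x) (A' t y)
  eq_zero : ∀ t x, A t x = 0 → A' t x = 0 → x = 0

namespace IsLagrangeTensor

variable {R A A' : ℝ → E →L[ℝ] E}

theorem continuous (h : IsLagrangeTensor R A A') : Continuous A :=
  continuous_iff_continuousAt.mpr fun t => (h.hasDerivAt t).continuousAt

theorem continuous' (h : IsLagrangeTensor R A A') : Continuous A' :=
  continuous_iff_continuousAt.mpr fun t => (h.hasDerivAt' t).continuousAt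

theorem hasDerivAt_apply (h : IsLagrangeTensor R A A') (t : ℝ) (x : E) :
    HasDerivAt (fun s => A s x) (A' t x) t :=
  (ContinuousLinearMap.apply ℝ E x).hasFDerivAt.comp_hasDerivAt t (h.hasDerivAt t)

/-- The hard case is `A t₀ x₀ = 0`, where `w = A' t₀ x₀ ≠ 0`. Expanding `A t x` directly fails,
since `x` moves independently of `t`. Symmetry instead gives `⟨A t x, A' t x₀⟩ = ⟨A' t x, A t x₀⟩ ≈
(t - t₀) ‖w‖²`, so `A t x` cannot be smaller than order `|t - t₀|`. -/
theorem exists_lower_bound_nhds (h : IsLagrangeTensor R A A') (t₀ : ℝ) {x₀ : E} (hx₀ : x₀ ≠ 0) :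
    ∃ c > 0, ∀ᶠ p : ℝ × E in 𝓝 t₀ ×ˢ 𝓝 x₀, c * |p.1 - t₀| ≤ ‖A p.1 p.2‖ := by
  rw [← nhds_prod_eq]
  have hcA : Continuous fun p : ℝ × E => A p.1 p.2 :=
    (h.continuous.comp continuous_fst).clm_apply continuous_snd
  have hcA' : Continuous fun p : ℝ × E => A' p.1 p.2 :=
    (h.continuous'.comp continuous_fst).clm_apply continuous_snd
  by_cases hA : A t₀ x₀ = 0
  · obtain ⟨w, hw⟩ : ∃ w, w = A' t₀ x₀ := ⟨_, rfl⟩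
    have hw0 : 0 < ‖w‖ := by
      rw [norm_pos_iff, hw]
      exact fun h0 => hx₀ (h.eq_zero t₀ x₀ hA h0)
    -- With errors of `‖w‖ / 4`, the pairing is at least `(3/4 - 5/16) ‖w‖² |t - t₀|` and at most
    -- `5/4 ‖w‖ ‖A t x‖`, which leaves room for the constant `1/8`.
    refine ⟨‖w‖ / 8, by positivity, ?_⟩
    have hlin : ∀ᶠ p : ℝ × E in 𝓝 (t₀, x₀),
        ‖A p.1 x₀ - (p.1 - t₀) • w‖ ≤ ‖w‖ / 4 * |p.1 - t₀| := by
      have h1 := (hasDerivAt_iff_isLittleO.mp (h.hasDerivAt_apply t₀ x₀)).bound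
        (show 0 < ‖w‖ / 4 by positivity)
      rw [hA, ← hw] at h1
      simpa only [sub_zero, Real.norm_eq_abs] using
        (continuous_fst.tendsto (t₀, x₀)).eventually h1
    have hnear : ∀ᶠ p : ℝ × E in 𝓝 (t₀, x₀), ‖A' p.1 p.2 - w‖ < ‖w‖ / 4 := by
      have := (hcA'.tendsto (t₀, x₀)).eventually (Metric.ball_mem_nhds _
        (show 0 < ‖w‖ / 4 by positivity))
      simpa only [← hw, Metric.mem_ball, dist_eq_norm] using this
    have hnear' : ∀ᶠ p : ℝ × E in 𝓝 (t₀, x₀), ‖A' p.1 x₀ - w‖ < ‖w‖ / 4 := by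
      have hc : Continuous fun p : ℝ × E => A' p.1 x₀ :=
        (h.continuous'.comp continuous_fst).clm_apply continuous_const
      have := (hc.tendsto (t₀, x₀)).eventually (Metric.ball_mem_nhds _
        (show 0 < ‖w‖ / 4 by positivity))
      simpa only [← hw, Metric.mem_ball, dist_eq_norm] using this
    filter_upwards [hlin, hnear, hnear'] with p h1 h2 h3
    have e1 := h.inner_comm p.1 p.2 x₀
    have e2 : inner ℝ (A' p.1 p.2) (A p.1 x₀) = (p.1 - t₀) * (‖w‖ ^ 2 + inner ℝ (A' p.1 p.2 - w) w)
        + inner ℝ (A' p.1 p.2) (A p.1 x₀ - (p.1 - t₀) • w) := by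
      rw [inner_sub_right, inner_sub_left, real_inner_smul_right, real_inner_self_eq_norm_sq]
      ring
    have b1 : |inner ℝ (A' p.1 p.2 - w) w| ≤ ‖w‖ / 4 * ‖w‖ :=
      (abs_real_inner_le_norm _ _).trans (by gcongr)
    have n1 : ‖A' p.1 p.2‖ ≤ 5 / 4 * ‖w‖ := by
      linarith [norm_le_norm_add_norm_sub' (A' p.1 p.2) w]
    have n2 : ‖A' p.1 x₀‖ ≤ 5 / 4 * ‖w‖ := by
      linarith [norm_le_norm_add_norm_sub' (A' p.1 x₀) w]
    have b2 : |inner ℝ (A' p.1 p.2) (A p.1 x₀ - (p.1 - t₀) • w)| ≤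
        5 / 4 * ‖w‖ * (‖w‖ / 4 * |p.1 - t₀|) :=
      (abs_real_inner_le_norm _ _).trans (by gcongr)
    have b3 : |inner ℝ (A p.1 p.2) (A' p.1 x₀)| ≤ ‖A p.1 p.2‖ * (5 / 4 * ‖w‖) :=
      (abs_real_inner_le_norm _ _).trans (by gcongr)
    have b4 : |p.1 - t₀| * (3 / 4 * ‖w‖ ^ 2) ≤
        |(p.1 - t₀) * (‖w‖ ^ 2 + inner ℝ (A' p.1 p.2 - w) w)| := by
      rw [abs_mul]
      gcongr
      refine le_trans ?_ (le_abs_self _)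
      linarith [neg_abs_le (inner ℝ (A' p.1 p.2 - w) w)]
    rw [← e1, e2] at b3
    have b5 := abs_sub_abs_le_abs_sub ((p.1 - t₀) * (‖w‖ ^ 2 + inner ℝ (A' p.1 p.2 - w) w))
      (-inner ℝ (A' p.1 p.2) (A p.1 x₀ - (p.1 - t₀) • w))
    rw [abs_neg, sub_neg_eq_add] at b5
    have b6 : ‖w‖ / 8 * |p.1 - t₀| * (5 / 4 * ‖w‖) ≤ ‖A p.1 p.2‖ * (5 / 4 * ‖w‖) := by
      have : 0 ≤ |p.1 - t₀| * ‖w‖ ^ 2 := by positivity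
      linarith
    exact le_of_mul_le_mul_right b6 (by positivity)
  · have hA0 : 0 < ‖A t₀ x₀‖ := norm_pos_iff.mpr hA
    refine ⟨‖A t₀ x₀‖ / 2, by positivity, ?_⟩
    have h1 : ∀ᶠ p : ℝ × E in 𝓝 (t₀, x₀), ‖A t₀ x₀‖ / 2 < ‖A p.1 p.2‖ :=
      (hcA.norm.tendsto (t₀, x₀)).eventually (lt_mem_nhds (half_lt_self hA0))
    have h2 : ∀ᶠ p : ℝ × E in 𝓝 (t₀, x₀), |p.1 - t₀| < 1 := by
      have := (continuous_fst.tendsto (t₀, x₀)).eventually (Metric.ball_mem_nhds t₀ one_pos)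
      simpa only [Metric.mem_ball, Real.dist_eq] using this
    filter_upwards [h1, h2] with p h1 h2
    nlinarith

/-- The singularities of a Lagrange tensor are at most of the first order. -/
theorem exists_lower_bound [FiniteDimensional ℝ E] (h : IsLagrangeTensor R A A') (t₀ : ℝ) :
    ∃ c > 0, ∀ᶠ t in 𝓝 t₀, ∀ x, c * |t - t₀| * ‖x‖ ≤ ‖A t x‖ := by
  obtain ⟨c, hc, hev⟩ : ∃ c > 0, ∀ᶠ t in 𝓝 t₀, ∀ x ∈ Metric.sphere (0 : E) 1,
      c * |t - t₀| ≤ ‖A t x‖ := by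
    -- Compactness of the unit sphere makes the local constants uniform in `x`.
    refine (isCompact_sphere (0 : E) 1).induction_on
      (p := fun s => ∃ c > 0, ∀ᶠ t in 𝓝 t₀, ∀ x ∈ s, c * |t - t₀| ≤ ‖A t x‖) ?_ ?_ ?_ ?_
    · exact ⟨1, one_pos, by simp⟩
    · rintro s u hsu ⟨c, hc, hev⟩
      exact ⟨c, hc, hev.mono fun t ht x hx => ht x (hsu hx)⟩
    · rintro s u ⟨c, hc, hev⟩ ⟨d, hd, hev'⟩
      refine ⟨min c d, lt_min hc hd, ?_⟩
      filter_upwards [hev, hev'] with t h1 h2 x hx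
      rcases hx with hx | hx
      · exact (mul_le_mul_of_nonneg_right (min_le_left _ _) (abs_nonneg _)).trans (h1 x hx)
      · exact (mul_le_mul_of_nonneg_right (min_le_right _ _) (abs_nonneg _)).trans (h2 x hx)
    · intro x hx
      obtain ⟨c, hc, hev⟩ := h.exists_lower_bound_nhds t₀ (x₀ := x)
        (Metric.ne_of_mem_sphere hx one_ne_zero)
      obtain ⟨P, hP, Q, hQ, hPQ⟩ := eventually_prod_iff.mp hev
      exact ⟨{y | Q y}, mem_nhdsWithin_of_mem_nhds hQ, c, hc, hP.mono fun t ht y hy => hPQ ht hy⟩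
  refine ⟨c, hc, hev.mono fun t ht x => ?_⟩
  rcases eq_or_ne x 0 with rfl | hx
  · simp
  have hx0 : 0 < ‖x‖ := norm_pos_iff.mpr hx
  have h1 := ht (‖x‖⁻¹ • x) (by simp [norm_smul, hx0.ne'])
  rw [map_smul, norm_smul, norm_inv, norm_norm] at h1
  calc c * |t - t₀| * ‖x‖ ≤ ‖x‖⁻¹ * ‖A t x‖ * ‖x‖ := by gcongr
    _ = ‖A t x‖ := by field_simp

theorem eventually_ker_eq_bot [FiniteDimensional ℝ E] (h : IsLagrangeTensor R A A') (t₀ : ℝ) :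
    ∀ᶠ t in 𝓝[≠] t₀, (A t : E →ₗ[ℝ] E).ker = ⊥ := by
  obtain ⟨c, hc, hev⟩ := h.exists_lower_bound t₀
  filter_upwards [nhdsWithin_le_nhds hev, self_mem_nhdsWithin] with t ht hne
  rw [LinearMap.ker_eq_bot']
  intro x hx
  have hx' : A t x = 0 := hx
  have h1 := ht x
  rw [hx', norm_zero] at h1
  have h2 : 0 < c * |t - t₀| := mul_pos hc (abs_pos.mpr (sub_ne_zero.mpr hne))
  exact norm_le_zero_iff.mp (nonpos_of_mul_nonpos_right h1 h2)

/-- The singularities of a Lagrange tensor are isolated. -/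
theorem finite_singular [FiniteDimensional ℝ E] (h : IsLagrangeTensor R A A') (a b : ℝ) :
    {t ∈ Icc a b | (A t : E →ₗ[ℝ] E).ker ≠ ⊥}.Finite := by
  by_contra hinf
  obtain ⟨t, -, ht⟩ := Set.Infinite.exists_accPt_of_subset_isCompact hinf isCompact_Icc
    (sep_subset _ _)
  obtain ⟨s, hs, hs'⟩ := ((accPt_iff_frequently_nhdsNE.mp ht).and_eventually
    (h.eventually_ker_eq_bot t)).exists
  exact hs.2 hs'

/-- Symmetry makes `A' t (ker A t)` orthogonal to `range (A t)`. As `A' t` is injective on `ker A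
t`, rank-nullity shows that it is the whole orthogonal complement. -/
theorem mem_range [FiniteDimensional ℝ E] (h : IsLagrangeTensor R A A') (t : ℝ) {v : E}
    (hv : ∀ k, A t k = 0 → inner ℝ v (A' t k) = 0) : ∃ y, A t y = v := by
  let A₀ : E →ₗ[ℝ] E := A t
  let K : Submodule ℝ E := ((A' t : E →ₗ[ℝ] E) ∘ₗ A₀.ker.subtype).range
  have hK : K ≤ A₀.rangeᗮ := by
    rintro _ ⟨⟨k, hk⟩, rfl⟩ _ ⟨y, rfl⟩
    have hk' : A t k = 0 := hk
    change inner ℝ (A t y) (A' t k) = 0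
    rw [← h.inner_comm, hk', inner_zero_right]
  have hrank : Module.finrank ℝ K = Module.finrank ℝ A₀.ker := by
    refine LinearMap.finrank_range_of_inj ?_
    rw [← LinearMap.ker_eq_bot, LinearMap.ker_eq_bot']
    rintro ⟨k, hk⟩ hk'
    exact Subtype.ext (h.eq_zero t k hk hk')
  have hEq : K = A₀.rangeᗮ := by
    refine Submodule.eq_of_le_of_finrank_le hK ?_
    have h1 := A₀.range.finrank_add_finrank_orthogonal
    have h2 := A₀.finrank_range_add_finrank_ker
    omega
  have hvK : v ∈ Kᗮ := by
    rintro _ ⟨⟨k, hk⟩, rfl⟩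
    rw [real_inner_comm]
    exact hv k hk
  rw [hEq, Submodule.orthogonal_orthogonal] at hvK
  exact hvK

end IsLagrangeTensor

end LagrangeTensor

/-! ### Riccati comparison and the count over one interval -/

section Riccati

/-- Cutting the interval at an exceptional point leaves two intervals with fewer such points;
continuity suffices at the cut. -/
theorem le_of_hasDerivAt_nonpos_off_finset {f : ℝ → ℝ} (S : Finset ℝ) {a b : ℝ} (hab : a ≤ b)
    (hc : ContinuousOn f (Icc a b))
    (hd : ∀ t ∈ Ioo a b, t ∉ S → ∃ f' ≤ 0, HasDerivAt f f' t) : f b ≤ f a := by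
  induction S using Finset.induction_on generalizing a b with
  | empty =>
    refine antitoneOn_of_deriv_nonpos (convex_Icc a b) hc ?_ ?_ (left_mem_Icc.mpr hab)
      (right_mem_Icc.mpr hab) hab
    · rw [interior_Icc]
      intro t ht
      obtain ⟨f', -, hf⟩ := hd t ht (by simp)
      exact hf.differentiableAt.differentiableWithinAt
    · rw [interior_Icc]
      intro t ht
      obtain ⟨f', hf', hf⟩ := hd t ht (by simp)
      rwa [hf.deriv]
  | insert p S _ ih =>
    by_cases hp : p ∈ Ioo a b
    · refine (ih hp.2.le (hc.mono (Icc_subset_Icc_left hp.1.le)) fun t ht htS => ?_).trans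
        (ih hp.1.le (hc.mono (Icc_subset_Icc_right hp.2.le)) fun t ht htS => ?_)
      · exact hd t ⟨hp.1.trans ht.1, ht.2⟩ (by simp [htS, ht.1.ne'])
      · exact hd t ⟨ht.1, ht.2.trans hp.2⟩ (by simp [htS, ht.2.ne])
    · exact ih hab hc fun t ht htS => hd t ht (by
        rw [Finset.mem_insert, not_or]
        exact ⟨fun h => hp (h ▸ ht), htS⟩)

/-- A function on `(c, b]` that satisfies the Riccati inequality `q' ≤ -q² - δ` lives on an
interval of length less than `π / √δ`. -/
theorem riccati_length_lt {q : ℝ → ℝ} (S : Finset ℝ) {c b δ : ℝ} (hδ : 0 < δ) (hcb : c < b)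
    (hc : ContinuousOn q (Ioc c b))
    (hd : ∀ t ∈ Ioo c b, t ∉ S → ∃ q' ≤ -q t ^ 2 - δ, HasDerivAt q q' t) :
    b < c + Real.pi / Real.sqrt δ := by
  obtain ⟨σ, hσ⟩ : ∃ σ, σ = Real.sqrt δ := ⟨_, rfl⟩
  have hσ0 : 0 < σ := hσ ▸ Real.sqrt_pos.mpr hδ
  have hσ2 : σ ^ 2 = δ := hσ ▸ Real.sq_sqrt hδ.le
  rw [← hσ]
  -- The inequality says that `arctan (q / σ)` decreases at rate at least `σ`.
  have key : ∀ s ∈ Ioo c b, Real.arctan (q b / σ) + σ * b ≤ Real.arctan (q s / σ) + σ * s := by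
    intro s hs
    refine le_of_hasDerivAt_nonpos_off_finset (f := fun t => Real.arctan (q t / σ) + σ * t) S
      hs.2.le ?_ ?_
    · have hq : ContinuousOn q (Icc s b) := hc.mono fun t ht => ⟨hs.1.trans_le ht.1, ht.2⟩
      exact (Real.continuous_arctan.comp_continuousOn (hq.div_const σ)).add
        (continuousOn_const.mul continuousOn_id)
    · intro t ht htS
      obtain ⟨q', hq', hq⟩ := hd t ⟨hs.1.trans ht.1, ht.2⟩ htS
      refine ⟨_, ?_, (hq.div_const σ).arctan.add ((hasDerivAt_id t).const_mul σ)⟩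
      have e : 1 / (1 + (q t / σ) ^ 2) * (q' / σ) + σ * 1 =
          σ * (q' + q t ^ 2 + σ ^ 2) / (σ ^ 2 + q t ^ 2) := by
        field_simp
        ring
      rw [e]
      refine div_nonpos_of_nonpos_of_nonneg ?_ (by positivity)
      refine mul_nonpos_of_nonneg_of_nonpos hσ0.le ?_
      linarith
  -- `q` may blow up at `c`, so only `arctan < π / 2` is used there, and the limit `s → c` makes it
  -- non-strict. Strictness comes from `b`, where `q` has a value and `arctan > -π / 2`.
  have hle : σ * (b - c) ≤ Real.pi / 2 - Real.arctan (q b / σ) := by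
    have ht : Tendsto (fun s => σ * (b - s)) (𝓝[>] c) (𝓝 (σ * (b - c))) :=
      ((continuous_const.mul (continuous_const.sub continuous_id)).tendsto c).mono_left
        nhdsWithin_le_nhds
    refine le_of_tendsto ht ?_
    filter_upwards [Ioo_mem_nhdsGT hcb] with s hs
    have h1 := key s hs
    have h2 := Real.arctan_lt_pi_div_two (q s / σ)
    linarith
  have h3 := Real.neg_pi_div_two_lt_arctan (q b / σ)
  have h4 : b - c < Real.pi / σ := by
    rw [lt_div_iff₀ hσ0]
    linarith
  linarith

theorem finrank_biSup_le_sum {ι k V : Type*} [DivisionRing k] [AddCommGroup V] [Module k V]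
    [FiniteDimensional k V] (S : Finset ι) (K : ι → Submodule k V) :
    Module.finrank k (⨆ i ∈ S, K i : Submodule k V) ≤ ∑ i ∈ S, Module.finrank k (K i) := by
  classical
  induction S using Finset.induction_on with
  | empty => simp
  | insert i S hi ih =>
    rw [Finset.iSup_insert, Finset.sum_insert hi]
    exact (Submodule.finrank_add_le_finrank_add_finrank _ _).trans (Nat.add_le_add_left ih _)

variable {E : Type*} [NormedAddCommGroup E] [InnerProductSpace ℝ E] [FiniteDimensional ℝ E]

theorem isUnit_of_ker_eq_bot {B : E →L[ℝ] E} (hB : (B : E →ₗ[ℝ] E).ker = ⊥) : IsUnit B := by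
  refine ContinuousLinearMap.isUnit_iff_bijective.mpr ⟨LinearMap.ker_eq_bot.mp hB, ?_⟩
  exact LinearMap.injective_iff_surjective.mp (LinearMap.ker_eq_bot.mp hB)

namespace IsLagrangeTensor

variable {R A A' : ℝ → E →L[ℝ] E}

/-- The Riccati form `⟨A' A⁻¹ v, v⟩` extends continuously over the singularities at which `v`
stays in the range of `A`. -/
theorem continuousWithinAt_riccatiForm (h : IsLagrangeTensor R A A') {v : E} {y : ℝ → E}
    {s : Set ℝ} {t₀ : ℝ} (ht₀ : t₀ ∈ s) (hy : ∀ t ∈ s, A t (y t) = v) :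
    ContinuousWithinAt (fun t => inner ℝ (A' t (y t)) v : ℝ → ℝ) s t₀ := by
  obtain ⟨c, hc, hlow⟩ := h.exists_lower_bound t₀
  have hdiff := (h.hasDerivAt_apply t₀ (y t₀)).isBigO_sub
  obtain ⟨D, hD⟩ := hdiff.bound
  rw [hy t₀ ht₀] at hD
  have hA'b : ∀ᶠ t in 𝓝 t₀, ‖A' t‖ < ‖A' t₀‖ + 1 :=
    (h.continuous'.norm.tendsto t₀).eventually (gt_mem_nhds (lt_add_one _))
  -- Symmetry moves `A'` onto the fixed vector `y t₀` in the main term. In the remainder `y t` need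
  -- only be bounded, since `v - A t (y t₀)` tends to `0`.
  have heq : ∀ t ∈ s, inner ℝ (A' t (y t)) v =
      inner ℝ v (A' t (y t₀)) + inner ℝ (A' t (y t)) (v - A t (y t₀)) := by
    intro t ht
    rw [inner_sub_right, h.inner_comm t (y t) (y t₀), hy t ht]
    ring
  have h1 : Tendsto (fun t => inner ℝ v (A' t (y t₀))) (𝓝[s] t₀)
      (𝓝 (inner ℝ v (A' t₀ (y t₀)))) := by
    have hcont : Continuous fun t => inner ℝ v (A' t (y t₀)) :=
      continuous_const.inner (h.continuous'.clm_apply continuous_const)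
    exact (hcont.tendsto t₀).mono_left nhdsWithin_le_nhds
  have h2 : Tendsto (fun t => inner ℝ (A' t (y t)) (v - A t (y t₀))) (𝓝[s] t₀) (𝓝 0) := by
    have hcont : Continuous fun t => (‖A' t₀‖ + 1) * (‖y t₀‖ + D / c) * ‖v - A t (y t₀)‖ :=
      continuous_const.mul (continuous_const.sub (h.continuous.clm_apply continuous_const)).norm
    have hz := (hcont.tendsto t₀).mono_left (nhdsWithin_le_nhds (s := s))
    rw [hy t₀ ht₀, sub_self, norm_zero, mul_zero] at hz
    refine squeeze_zero_norm' ?_ hz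
    filter_upwards [self_mem_nhdsWithin, nhdsWithin_le_nhds hlow, nhdsWithin_le_nhds hD,
      nhdsWithin_le_nhds hA'b] with t hts hl hDt hb
    rcases eq_or_ne t t₀ with rfl | hne
    · simp [hy t ht₀]
    have hpos : 0 < |t - t₀| := abs_pos.mpr (sub_ne_zero.mpr hne)
    -- `A t (y t - y t₀) = v - A t (y t₀)` is `O(|t - t₀|)`, and the first-order lower bound on `A
    -- t` cancels this factor. No continuity of `y` is assumed.
    have hyb : ‖y t - y t₀‖ ≤ D / c := by
      have e1 := hl (y t - y t₀)
      rw [map_sub, hy t hts] at e1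
      rw [norm_sub_rev] at hDt
      have e2 : ‖y t - y t₀‖ * c * |t - t₀| ≤ D * |t - t₀| := by
        calc ‖y t - y t₀‖ * c * |t - t₀| = c * |t - t₀| * ‖y t - y t₀‖ := by ring
          _ ≤ _ := e1.trans hDt
      rw [le_div_iff₀ hc]
      exact le_of_mul_le_mul_right e2 hpos
    have hyb' : ‖y t‖ ≤ ‖y t₀‖ + D / c := by
      linarith [norm_le_norm_add_norm_sub' (y t) (y t₀)]
    calc ‖inner ℝ (A' t (y t)) (v - A t (y t₀))‖ ≤ ‖A' t (y t)‖ * ‖v - A t (y t₀)‖ :=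
          norm_inner_le_norm _ _
      _ ≤ ‖A' t‖ * ‖y t‖ * ‖v - A t (y t₀)‖ := by gcongr; exact (A' t).le_opNorm _
      _ ≤ _ := by gcongr
  have h3 := h1.add h2
  rw [add_zero, real_inner_comm] at h3
  exact h3.congr' (eventually_nhdsWithin_of_forall fun t ht => (heq t ht).symm)

/-- The Riccati equation along a Lagrange tensor. -/
theorem hasDerivAt_riccatiForm (h : IsLagrangeTensor R A A') {v : E} {y : ℝ → E} {t₀ : ℝ}
    (hy : ∀ᶠ t in 𝓝 t₀, A t (y t) = v) (hker : (A t₀ : E →ₗ[ℝ] E).ker = ⊥) :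
    HasDerivAt (fun t => inner ℝ (A' t (y t)) v : ℝ → ℝ)
      (-‖A' t₀ (y t₀)‖ ^ 2 - inner ℝ (R t₀ v) v) t₀ := by
  have hunit : IsUnit (A t₀) := isUnit_of_ker_eq_bot hker
  have hunits : ∀ᶠ t in 𝓝 t₀, IsUnit (A t) :=
    (h.continuous.tendsto t₀).eventually (Units.isOpen.mem_nhds hunit)
  -- Near a regular time `y` agrees with `A⁻¹ v`, which is differentiable.
  obtain ⟨z, hz⟩ : ∃ z : ℝ → E, z = fun t => Ring.inverse (A t) v := ⟨_, rfl⟩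
  have hzy : ∀ᶠ t in 𝓝 t₀, z t = y t := by
    filter_upwards [hy, hunits] with t ht hu
    have : (Ring.inverse (A t) * A t) (y t) = y t := by
      rw [Ring.inverse_mul_cancel _ hu]; rfl
    change Ring.inverse (A t) (A t (y t)) = y t at this
    rw [ht] at this
    rw [hz, ← this]
  have hzA : ∀ᶠ t in 𝓝 t₀, A t (z t) = v := by
    filter_upwards [hy, hzy] with t h1 h2
    rw [h2, h1]
  obtain ⟨z', hz'⟩ : ∃ z', HasDerivAt z z' t₀ := by
    have hd : DifferentiableAt ℝ (fun t => Ring.inverse (A t)) t₀ :=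
      (h.hasDerivAt t₀).differentiableAt.inverse hunit
    rw [hz]
    exact ⟨_, (hd.clm_apply (differentiableAt_const v)).hasDerivAt⟩
  have hsum : A' t₀ (z t₀) + A t₀ z' = 0 := by
    have h1 := (h.hasDerivAt t₀).clm_apply hz'
    exact h1.unique ((hasDerivAt_const t₀ v).congr_of_eventuallyEq hzA)
  have hv := hzA.self_of_nhds
  have hd := ((h.hasDerivAt' t₀).clm_apply hz').inner ℝ (hasDerivAt_const t₀ v)
  rw [← hzy.self_of_nhds]
  refine (hd.congr_deriv ?_).congr_of_eventuallyEq (hzy.mono fun t ht => ?_)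
  -- `⟨A' z', A z⟩ = ⟨A z', A' z⟩` by symmetry, and `A z' = -A' z` from differentiating `A z = v`.
  · have e1 : inner ℝ (A' t₀ z') v = -‖A' t₀ (z t₀)‖ ^ 2 := by
      rw [← hv, h.inner_comm, eq_neg_of_add_eq_zero_right hsum, inner_neg_left,
        real_inner_self_eq_norm_sq]
    rw [inner_zero_right, inner_add_left, e1]
    simp only [neg_apply, ContinuousLinearMap.comp_apply, hv, inner_neg_left]
    ring
  · simp only [ht]

/-- Over a half-open interval of length `π / √δ` the singularities of a Lagrange tensor number at
least the dimension. -/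
theorem finrank_le_sum_finrank_ker (h : IsLagrangeTensor R A A') {δ : ℝ} (hδ : 0 < δ)
    (hR : ∀ (t : ℝ) (v : E), δ * ‖v‖ ^ 2 ≤ inner ℝ (R t v) v) (c : ℝ) :
    ∃ S : Finset ℝ, (S : Set ℝ) ⊆ Ioc c (c + Real.pi / Real.sqrt δ) ∧
      Module.finrank ℝ E ≤ ∑ t ∈ S, Module.finrank ℝ (A t : E →ₗ[ℝ] E).ker := by
  obtain ⟨b, hb⟩ : ∃ b, b = c + Real.pi / Real.sqrt δ := ⟨_, rfl⟩
  have hcb : c < b := by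
    have : 0 < Real.pi / Real.sqrt δ := div_pos Real.pi_pos (Real.sqrt_pos.mpr hδ)
    linarith
  rw [← hb]
  have hfin : {t ∈ Ioc c b | (A t : E →ₗ[ℝ] E).ker ≠ ⊥}.Finite :=
    (h.finite_singular c b).subset fun t ht => ⟨Ioc_subset_Icc_self ht.1, ht.2⟩
  refine ⟨hfin.toFinset, fun t ht => ?_, ?_⟩
  · exact (hfin.mem_toFinset.mp ht).1
  by_contra! hlt
  let K : ℝ → Submodule ℝ E := fun t => (A t : E →ₗ[ℝ] E).ker.map (A' t : E →ₗ[ℝ] E)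
  let V : Submodule ℝ E := ⨆ t ∈ hfin.toFinset, K t
  have hV : V ≠ ⊤ := by
    intro hV
    have h1 : Module.finrank ℝ V ≤ ∑ t ∈ hfin.toFinset, Module.finrank ℝ (K t) :=
      finrank_biSup_le_sum _ K
    rw [hV, finrank_top] at h1
    exact absurd (hlt.trans_le (h1.trans (Finset.sum_le_sum fun t _ =>
      Submodule.finrank_map_le _ _))) (lt_irrefl _)
  obtain ⟨w, hw, hw0⟩ := Submodule.exists_mem_ne_zero_of_ne_bot
    (mt Submodule.orthogonal_eq_bot_iff.mp hV)
  obtain ⟨v, hvV, hv1⟩ : ∃ v ∈ Vᗮ, ‖v‖ = 1 :=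
    ⟨‖w‖⁻¹ • w, Submodule.smul_mem _ _ hw, by simp [norm_smul, norm_ne_zero_iff.mpr hw0]⟩
  have hrange : ∀ t ∈ Ioc c b, ∃ y, A t y = v := by
    intro t ht
    refine h.mem_range t fun k hk => ?_
    rcases eq_or_ne k 0 with rfl | hk0
    · simp
    have htS : t ∈ hfin.toFinset := by
      rw [hfin.mem_toFinset]
      exact ⟨ht, (Submodule.ne_bot_iff _).mpr ⟨k, hk, hk0⟩⟩
    have hmem : A' t k ∈ V :=
      Submodule.mem_iSup_of_mem t (Submodule.mem_iSup_of_mem htS ⟨k, hk, rfl⟩)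
    rw [real_inner_comm]
    exact hvV _ hmem
  choose! y hy using hrange
  have hlen := riccati_length_lt (q := fun t => inner ℝ (A' t (y t)) v) hfin.toFinset hδ hcb
    (fun t ht => h.continuousWithinAt_riccatiForm ht hy) ?_
  · linarith
  · intro t ht htS
    have hker : (A t : E →ₗ[ℝ] E).ker = ⊥ := by
      by_contra hne
      exact htS (hfin.mem_toFinset.mpr ⟨Ioo_subset_Ioc_self ht, hne⟩)
    refine ⟨_, ?_, h.hasDerivAt_riccatiForm ?_ hker⟩
    -- Cauchy–Schwarz with `‖v‖ = 1` turns the Riccati equation into the scalar inequality for `q`.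
    · have e1 : (inner ℝ (A' t (y t)) v : ℝ) ^ 2 ≤ ‖A' t (y t)‖ ^ 2 := by
        rw [sq_le_sq, abs_norm]
        simpa [hv1] using abs_real_inner_le_norm (A' t (y t)) v
      have e2 := hR t v
      rw [hv1] at e2
      linarith
    · filter_upwards [isOpen_Ioo.mem_nhds ht] with s hs using hy s (Ioo_subset_Ioc_self hs)

end IsLagrangeTensor

end Riccati

/-! ### From Lagrangians to Lagrange tensors; additivity of the index -/

section Index

variable {E : Type*} [NormedAddCommGroup E] [InnerProductSpace ℝ E]
  {R : ℝ → E →L[ℝ] E}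

theorem le_index {L : Submodule ℝ (jacobiFields R)} {I : Set ℝ} {S : Finset ℝ}
    (hS : (S : Set ℝ) ⊆ I) : ((∑ t ∈ S, indexAt L t : ℕ) : ℕ∞) ≤ index L I :=
  le_iSup₂_of_le S hS le_rfl

theorem index_ne_top_of_finite {L : Submodule ℝ (jacobiFields R)} {I : Set ℝ}
    (hI : {t ∈ I | indexAt L t ≠ 0}.Finite) : index L I ≠ ⊤ := by
  classical
  refine ne_top_of_le_ne_top (ENat.natCast_ne_top (∑ t ∈ hI.toFinset, indexAt L t)) ?_
  refine iSup₂_le fun S hS => Nat.cast_le.mpr ?_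
  rw [← Finset.sum_filter_ne_zero]
  refine Finset.sum_le_sum_of_subset fun t ht => ?_
  rw [Finset.mem_filter] at ht
  exact hI.mem_toFinset.mpr ⟨hS ht.1, ht.2⟩

/-- If every half-open interval of length `ℓ` has weight at least `m`, then every half-open
interval of length `r * ℓ` has weight at least `r * m`. -/
theorem exists_finset_mul_le_sum {w : ℝ → ℕ} {ℓ : ℝ} {m : ℕ} (hℓ : 0 ≤ ℓ)
    (h : ∀ c, ∃ S : Finset ℝ, (S : Set ℝ) ⊆ Ioc c (c + ℓ) ∧ m ≤ ∑ t ∈ S, w t) (a : ℝ) (r : ℕ) :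
    ∃ S : Finset ℝ, (S : Set ℝ) ⊆ Ioc a (a + r * ℓ) ∧ r * m ≤ ∑ t ∈ S, w t := by
  classical
  induction r with
  | zero => exact ⟨∅, by simp, by simp⟩
  | succ r ih =>
    obtain ⟨S, hS, hSm⟩ := ih
    obtain ⟨T, hT, hTm⟩ := h (a + r * ℓ)
    have hr : 0 ≤ r * ℓ := by positivity
    refine ⟨S ∪ T, ?_, ?_⟩
    · rw [Finset.coe_union]
      push_cast
      refine union_subset (hS.trans (Ioc_subset_Ioc_right ?_)) (hT.trans (Ioc_subset_Ioc ?_ ?_))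
      all_goals linarith
    · rw [Finset.sum_union (Finset.disjoint_left.mpr fun t h1 h2 =>
        absurd (hS h1).2 (not_le.mpr (hT h2).1)), Nat.succ_mul]
      exact Nat.add_le_add hSm hTm

variable [FiniteDimensional ℝ E]

/-- In finite dimension an operator is a fixed continuous linear expression in its values on a
basis, so pointwise derivatives give one in operator norm. -/
theorem hasDerivAt_clm_of_apply {B B' : ℝ → E →L[ℝ] E} {t : ℝ}
    (h : ∀ x, HasDerivAt (fun s => B s x) (B' t x) t) : HasDerivAt B (B' t) t := by
  let b := stdOrthonormalBasis ℝ E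
  have hexp : ∀ C : E →L[ℝ] E, C = ∑ i, ContinuousLinearMap.smulRightL ℝ E E
      (innerSL ℝ (b i)) (C (b i)) := by
    intro C
    ext x
    conv_lhs => rw [← b.sum_repr' x]
    simp
  rw [hexp (B' t), funext fun s => hexp (B s)]
  exact HasDerivAt.fun_sum fun i _ =>
    (ContinuousLinearMap.smulRightL ℝ E E (innerSL ℝ (b i))).hasFDerivAt.comp_hasDerivAt t (h (b i))

/-- A Lagrangian is the span of the columns of a Lagrange tensor. -/
theorem IsLagrangian.exists_isLagrangeTensor (hR : Continuous R)
    (hsymm : ∀ t, (R t : E →ₗ[ℝ] E).IsSymmetric) {L : Submodule ℝ (jacobiFields R)}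
    (hL : IsLagrangian L) :
    ∃ A A' : ℝ → E →L[ℝ] E, IsLagrangeTensor R A A' ∧
      ∀ t, indexAt L t = Module.finrank ℝ (A t : E →ₗ[ℝ] E).ker := by
  have := (phaseEquiv hR).symm.finiteDimensional
  have : Module.Free ℝ L := Module.Free.of_divisionRing ℝ L
  -- Equal dimensions allow any linear identification; then `A t x` is the field `e x` at time `t`.
  let e : E ≃ₗ[ℝ] L := LinearEquiv.ofFinrankEq E L (hL.finrank_eq hR).symm
  let P : ℝ → E →ₗ[ℝ] E × E := fun t => phaseAt R t ∘ₗ L.subtype ∘ₗ e.toLinearMap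
  let A : ℝ → E →L[ℝ] E := fun t => (LinearMap.fst ℝ E E ∘ₗ P t).toContinuousLinearMap
  let A' : ℝ → E →L[ℝ] E := fun t => (LinearMap.snd ℝ E E ∘ₗ P t).toContinuousLinearMap
  have hA : ∀ t x, HasDerivAt (fun s => A s x) (A' t x) t := fun t x =>
    hasDerivAt_jacobiField (e x : jacobiFields R) t
  have hA' : ∀ t x, HasDerivAt (fun s => A' s x) (-(R t (A t x))) t := fun t x =>
    hasDerivAt_deriv_jacobiField (e x : jacobiFields R) t
  refine ⟨A, A', ⟨fun t => hasDerivAt_clm_of_apply (hA t),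
    fun t => hasDerivAt_clm_of_apply (B' := fun t => -(R t ∘L A t)) (hA' t), ?_, ?_⟩, fun t => ?_⟩
  · intro t x y
    have h := symplecticForm_eq hsymm (e x : jacobiFields R) (e y) t
    rw [hL.prop _ (e x).2 _ (e y).2] at h
    exact (sub_eq_zero.mp h.symm).symm
  · intro t x h1 h2
    have h := phaseAt_injective hR t
      (show phaseAt R t (e x) = phaseAt R t 0 by rw [map_zero]; exact Prod.ext h1 h2)
    exact e.map_eq_zero_iff.mp (Subtype.ext h)
  · refine LinearEquiv.finrank_eq (LinearEquiv.symm ?_)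
    refine LinearEquiv.ofBijective
      ((L.subtype ∘ₗ e.toLinearMap).restrict (p := (A t : E →ₗ[ℝ] E).ker) (q := vanishingAt L t)
        fun x hx => ⟨(e x).2, hx⟩) ⟨?_, ?_⟩
    · intro x y hxy
      have hxy' : (e x : jacobiFields R) = e y := congrArg (vanishingAt L t).subtype hxy
      exact Subtype.ext (e.injective (Subtype.ext hxy'))
    · rintro ⟨J, hJ, hJ0⟩
      refine ⟨⟨e.symm ⟨J, hJ⟩, ?_⟩, ?_⟩
      · change ((e (e.symm ⟨J, hJ⟩) : jacobiFields R) : ℝ → E) t = 0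
        rw [e.apply_symm_apply]
        exact hJ0
      · refine Subtype.ext ?_
        change (e (e.symm ⟨J, hJ⟩) : jacobiFields R) = J
        rw [e.apply_symm_apply]

end Index

end AbstractJacobi

end

theorem mainTheorem6 {E : Type*} [NormedAddCommGroup E] [InnerProductSpace ℝ E]
    [FiniteDimensional ℝ E] (R : ℝ → E →L[ℝ] E) (hR : ContDiff ℝ ∞ R)
    (hsymm : ∀ t : ℝ, (R t : E →ₗ[ℝ] E).IsSymmetric)
    (δ : ℝ) (hδ : 0 < δ) (hRδ : ∀ (t : ℝ) (v : E), δ * ‖v‖ ^ 2 ≤ inner ℝ (R t v) v)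
    (L : Submodule ℝ (AbstractJacobi.jacobiFields R)) (hL : AbstractJacobi.IsLagrangian L)
    (a : ℝ) (r : ℕ) (hr : 0 < r) :
    AbstractJacobi.index L (Set.Icc a (a + r * Real.pi / Real.sqrt δ)) ≠ ⊤ ∧
      ((r * Module.finrank ℝ E + AbstractJacobi.indexAt L a : ℕ) : ℕ∞) ≤
        AbstractJacobi.index L (Set.Icc a (a + r * Real.pi / Real.sqrt δ)) := by
  obtain ⟨A, A', hA, hind⟩ := hL.exists_isLagrangeTensor hR.continuous hsymm
  rw [mul_div_assoc]
  have hℓ : 0 ≤ Real.pi / Real.sqrt δ := div_nonneg Real.pi_pos.le (Real.sqrt_nonneg δ)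
  constructor
  · refine AbstractJacobi.index_ne_top_of_finite
      ((hA.finite_singular a (a + r * (Real.pi / Real.sqrt δ))).subset ?_)
    rintro t ⟨htI, ht⟩
    refine ⟨htI, fun hbot => ht ?_⟩
    rw [hind, hbot, finrank_bot]
  · have hw : ∀ c, ∃ S : Finset ℝ, (S : Set ℝ) ⊆ Set.Ioc c (c + Real.pi / Real.sqrt δ) ∧
        Module.finrank ℝ E ≤ ∑ t ∈ S, AbstractJacobi.indexAt L t := by
      simpa only [hind] using hA.finrank_le_sum_finrank_ker hδ hRδ
    obtain ⟨S, hS, hSm⟩ := AbstractJacobi.exists_finset_mul_le_sum hℓ hw a r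
    -- The intervals omit their left ends, so the index at `a` has not been counted yet.
    have haS : a ∉ S := fun h => lt_irrefl a (hS h).1
    refine le_trans (Nat.cast_le.mpr ?_) (AbstractJacobi.le_index (S := insert a S) ?_)
    · rw [Finset.sum_insert haS, add_comm]
      exact Nat.add_le_add_left hSm _
    · rw [Finset.coe_insert]
      refine Set.insert_subset (Set.left_mem_Icc.mpr ?_) (hS.trans Set.Ioc_subset_Icc_self)
      exact le_add_of_nonneg_right (mul_nonneg r.cast_nonneg hℓ)
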